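/- **Pushdown automata.** Fix a finite alphabet $\Sigma$. A PDA has finitely many states, a finite stack alphabet, a start state and a set of accepting states, is nondeterministic, and is in real-time (Greibach) normal form: each step reads exactly one input letter, pops at most one stack symbol and then pushes at most two stack symbols (intermediate $\varepsilon$-moves being fused into the step). It starts with an empty stack and accepts by accepting state or, alternatively, by accepting state together with empty stack. The *push-pop matching* of an accepting computation on $w$ is the set of arcs $(i,j)$ such that a symbol pushed at input position $i$ is popped at input position $j$ (positions are $1,\dots,|w|$). **Crossing pairs.** Let $M_1,M_2$ be PDAs over $\Sigma$. Given accepting computations of $M_1$ and of $M_2$ on $w$, a *crossing pair* consists of arcs $(i,j)$ and $(i',j')$, one from the matching of each machine (in either order), with $i<i'<j<j'$. It induces the factorization $w=P_1P_2P_3P_4$ with $P_1=w[1..i]$, $P_2=w[i{+}1..i']$, $P_3=w[i'{+}1..j]$, $P_4=w[j{+}1..|w|]$; its *inner segment measure* is $\max(|P_2|,|P_3|)=\max(i'-i,\,j-i')$. **Linkages.** For $L\subseteq\Sigma^*$ and $w=P_1P_2P_3P_4$, the pair $(P_k,P_l)$, $k<l$, is a *pump-sensitive linkage* in $L$ if for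 every factorization $w=uvxyz$ with $|vy|\ge 1$ such that (the block of positions occupied by) $vxy$ intersects $P_k$ and is disjoint from $P_l$, or intersects $P_l$ and is disjoint from $P_k$, one has $uv^2xy^2z\notin L$. **Corollary (Inner segment dichotomy).** Let $M_1,M_2$ be PDAs as above and $L=L(M_1)\cap L(M_2)$. (a) Suppose that there is a constant $D$ such that for every $w\in L$ there are accepting computations of $M_1$ and $M_2$ on $w$ all of whose crossing pairs have inner segment measure at most $D$. Then $L$ is context-free. (b) Suppose that for infinitely many $n$ there are a word $w_n\in L$ and accepting computations of $M_1$ and $M_2$ on $w_n$ with a crossing pair whose induced factorization $w_n=P_1P_2P_3P_4$ has the pump-sensitive linkages $(P_1,P_3)$ and $(P_2,P_4)$ in $L$ and satisfies $\max(|P_2|,|P_3|)\ge n$. Then $L$ is not context-free. -/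

import Mathlib

/-- A nondeterministic pushdown automaton over the input alphabet `α`, with states `Q` and stack
alphabet `Γ`, in real-time (Greibach) normal form. A transition `step q a o γs q'` leads from `q`
to `q'`, reads exactly one input letter `a`, pops at most one symbol (`o = some γ`: the symbol `γ`
has to be on top and is removed; `o = none`: nothing is popped), and then pushes the word `γs` of
at most two symbols, whose head becomes the new top of the stack. The auxiliary `ε`-moves that
separate a step into single stack operations are fused into the step that they belong to, so that
every input position carries at most one pop and at most two pushes.
A computation begins with the empty stack; it accepts if it ends in a state of `final` and,
if `emptyStack = true`, moreover with the empty stack. -/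
structure PDA (α : Type*) (Q : Type*) (Γ : Type*) where
  step : Q → α → Option Γ → List Γ → Q → Prop
  push_le : ∀ q a o γs q', step q a o γs q' → γs.length ≤ 2
  start : Q
  final : Set Q
  emptyStack : Bool

namespace PDA

variable {α Q Γ : Type*}

/-- `M.Run w q s A`: some computation of `M` reads `w` from the initial configuration and ends in
the state `q` with the stack `s` (top first), and its push-pop matching is `A`. Every symbol on
the stack carries the input position (counted from `1`) at which it was pushed; `(i, j) ∈ A` means
that the symbol popped at position `j` is one that was pushed at position `i`. -/
inductive Run (M : PDA α Q Γ) : List α → Q → List (Γ × ℕ) → Set (ℕ × ℕ) → Prop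
  | nil : Run M [] M.start [] ∅
  | noPop {w : List α} {q q' : Q} {s : List (Γ × ℕ)} {A : Set (ℕ × ℕ)} {a : α} {γs : List Γ} :
      Run M w q s A → M.step q a none γs q' →
        Run M (w ++ [a]) q' (γs.map (fun γ => (γ, w.length + 1)) ++ s) A
  | pop {w : List α} {q q' : Q} {s : List (Γ × ℕ)} {A : Set (ℕ × ℕ)} {a : α} {γs : List Γ}
      {γ : Γ} {i : ℕ} :
      Run M w q ((γ, i) :: s) A → M.step q a (some γ) γs q' →
        Run M (w ++ [a]) q' (γs.map (fun γ' => (γ', w.length + 1)) ++ s)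
          (insert (i, w.length + 1) A)

/-- `A` is the push-pop matching of some accepting computation of `M` on `w`. -/
def IsMatching (M : PDA α Q Γ) (w : List α) (A : Set (ℕ × ℕ)) : Prop :=
  ∃ q s, M.Run w q s A ∧ q ∈ M.final ∧ (M.emptyStack = true → s = [])

/-- The language of `M`: the words on which `M` has an accepting computation. -/
def language (M : PDA α Q Γ) : Language α :=
  {w | ∃ A, M.IsMatching w A}

end PDA

/-- The arcs `(i, j)` and `(i', j')` belong to different ones of the matchings `A₁`, `A₂`
(in either order) and cross, with `(i, j)` the left-starting arc. -/
def IsCrossingPair (A₁ A₂ : Set (ℕ × ℕ)) (i j i' j' : ℕ) : Prop :=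
  (((i, j) ∈ A₁ ∧ (i', j') ∈ A₂) ∨ ((i, j) ∈ A₂ ∧ (i', j') ∈ A₁)) ∧ i < i' ∧ i' < j ∧ j < j'

/-- The segments `P₁ = w[1..i]`, `P₂ = w[i+1..i']`, `P₃ = w[i'+1..j]`, `P₄ = w[j+1..|w|]`
(positions counted from `1`) cut out of `w` by crossing arcs `(i, j)`, `(i', j')`
with `i < i' < j < j'`. -/
def crossingSegments {α : Type*} (w : List α) (i i' j : ℕ) : List (List α) :=
  [w.take i, (w.take i').drop i, (w.take j).drop i', w.drop j]

/-- The larger of the lengths `i' - i` of `P₂` and `j - i'` of `P₃`. -/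
def innerSegmentMeasure (i i' j : ℕ) : ℕ := max (i' - i) (j - i')

/-- The positions (here counted from `0`) that the `k`-th segment of `P` (also counted from `0`)
occupies in the concatenation of `P`. -/
def segmentPositions {α : Type*} (P : List (List α)) (k : ℕ) : Set ℕ :=
  Set.Ico (P.take k).flatten.length (P.take (k + 1)).flatten.length

/-- `L` has a pump-sensitive linkage between the segments number `k` and `l` (counted from `0`)
of the word that is the concatenation of the consecutive segments `P`: every factorization
`u v x y z` of the word with `|vy| ≥ 1` whose middle part `vxy` meets exactly one
of the two segments satisfies `u v² x y² z ∉ L`. -/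
def PumpSensitiveLinkage {α : Type*} (L : Language α) (P : List (List α)) (k l : ℕ) : Prop :=
  ∀ u v x y z : List α, P.flatten = u ++ v ++ x ++ y ++ z → 1 ≤ (v ++ y).length →
    let I : Set ℕ := Set.Ico u.length (u ++ v ++ x ++ y).length
    ((I ∩ segmentPositions P k).Nonempty ∧ Disjoint I (segmentPositions P l)) ∨
      ((I ∩ segmentPositions P l).Nonempty ∧ Disjoint I (segmentPositions P k)) →
    u ++ v ++ v ++ x ++ y ++ y ++ z ∉ L

/-! For (a), both automata run in parallel on one common stack, sorted by the position at which its
symbols will be popped, the earliest on top. The finite control holds, for each automaton, the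
symbols that are due within the next `D` positions. A symbol pushed at `t` and due after `t + D` has
to go on the common stack. This would break the order only above a symbol `z` of the other automaton
that is due earlier, but still after `t + D`. As `z` was pushed before `t`, the two arcs would then
cross with `|P₃| > D`, which is excluded (`simulates_of_labeled`). Symbols of the same automaton are
in order anyway.

Symbols that are never popped would obstruct the common stack; the simulation forgets them. A flag
keeps this sound: an automaton may forget only while none of its symbols lie on the common stack,
and never if it has to accept with empty stack. Hence every computation of the product projects to
genuine computations of both automata (`moves_of_balanced`), so the product reads exactly the
intersection. At the end of a simulation the common stack is empty, and the words read by such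
balanced computations are generated by the usual grammar whose nonterminals are pairs of states
(`isContextFree_balanced`).

For (b), the pumping lemma gives a short window `vxy` that can be doubled within the language. By
the two linkages it meets `P₁` iff it meets `P₃`, and `P₂` iff it meets `P₄`. Being an interval, it
then covers `P₂` and `P₃`, so these have bounded length. -/

/-! ### Parse forests and the pumping lemma. -/

namespace ContextFreeGrammar

variable {T : Type*} {g : ContextFreeGrammar T}

/-- `g.Forest X s w`: the sentential form `s` yields the terminal word `w` by a parse forest in
which no nonterminal repeats along a path and none belongs to `X`. -/
inductive Forest (g : ContextFreeGrammar T) : Set g.NT → List (Symbol T g.NT) → List T → Prop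
  | nil (X : Set g.NT) : Forest g X [] []
  | terminal {X : Set g.NT} (a : T) {s : List (Symbol T g.NT)} {w : List T} :
      Forest g X s w → Forest g X (.terminal a :: s) (a :: w)
  | nonterminal {X : Set g.NT} {r : ContextFreeRule T g.NT} {s : List (Symbol T g.NT)}
      {u w : List T} : r.input ∉ X → r ∈ g.rules → Forest g (insert r.input X) r.output u →
      Forest g X s w → Forest g X (.nonterminal r.input :: s) (u ++ w)

/-- `g.Yields s w`: the sentential form `s` has a parse forest with yield `w`. -/
inductive Yields (g : ContextFreeGrammar T) : List (Symbol T g.NT) → List T → Prop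
  | nil : Yields g [] []
  | terminal (a : T) {s : List (Symbol T g.NT)} {w : List T} :
      Yields g s w → Yields g (.terminal a :: s) (a :: w)
  | nonterminal {r : ContextFreeRule T g.NT} {s : List (Symbol T g.NT)} {u w : List T} :
      r ∈ g.rules → Yields g r.output u → Yields g s w →
      Yields g (.nonterminal r.input :: s) (u ++ w)

lemma Yields.append {s t : List (Symbol T g.NT)} {u w : List T} (hs : g.Yields s u)
    (ht : g.Yields t w) : g.Yields (s ++ t) (u ++ w) := by
  induction hs with
  | nil => exact ht
  | terminal a _ ih => exact .terminal a ih
  | nonterminal hr ho _ _ ih => rw [List.append_assoc]; exact .nonterminal hr ho ih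

lemma Yields.exists_append {s t : List (Symbol T g.NT)} {w : List T} (h : g.Yields (s ++ t) w) :
    ∃ u v, w = u ++ v ∧ g.Yields s u ∧ g.Yields t v := by
  induction s generalizing w with
  | nil => exact ⟨[], w, rfl, .nil, h⟩
  | cons x s ih =>
    cases h with
    | terminal a h =>
      obtain ⟨u, v, rfl, hu, hv⟩ := ih h
      exact ⟨a :: u, v, rfl, .terminal a hu, hv⟩
    | nonterminal hr ho h =>
      obtain ⟨u, v, rfl, hu, hv⟩ := ih h
      exact ⟨_, v, (List.append_assoc ..).symm, .nonterminal hr ho hu, hv⟩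

lemma Yields.single {r : ContextFreeRule T g.NT} {w : List T} (hr : r ∈ g.rules)
    (h : g.Yields r.output w) : g.Yields [.nonterminal r.input] w := by
  simpa using Yields.nonterminal hr h .nil

lemma yields_map_terminal (w : List T) : g.Yields (w.map .terminal) w := by
  induction w with
  | nil => exact .nil
  | cons a w ih => exact .terminal a ih

lemma Yields.derives {s : List (Symbol T g.NT)} {w : List T} (h : g.Yields s w) :
    g.Derives s (w.map .terminal) := by
  induction h with
  | nil => rfl
  | terminal a _ ih => exact ih.append_left [.terminal a]
  | @nonterminal r s u w hr _ _ ih₁ ih₂ =>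
    rw [List.map_append]
    refine Derives.trans (v := r.output ++ s) ?_ ((ih₁.append_right s).trans (ih₂.append_left _))
    exact Produces.single ⟨r, hr, .head s⟩

/-- From right to left, the derivation is undone from its last step: the part of the word that stems
from the right side of the rule is cut out and becomes a subtree. -/
lemma yields_iff_derives {s : List (Symbol T g.NT)} {w : List T} :
    g.Yields s w ↔ g.Derives s (w.map .terminal) := by
  refine ⟨Yields.derives, fun h => ?_⟩
  induction h using Relation.ReflTransGen.head_induction_on with
  | refl => exact yields_map_terminal w
  | head hst _ ih =>
    obtain ⟨r, hr, hrw⟩ := hst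
    obtain ⟨p, q, rfl, rfl⟩ := hrw.exists_parts
    obtain ⟨u, v, rfl, hu, hv⟩ := ih.exists_append
    obtain ⟨u₁, u₂, rfl, hu₁, hu₂⟩ := hu.exists_append
    exact (hu₁.append (.single hr hu₂)).append hv

lemma mem_language_iff_yields {w : List T} :
    w ∈ g.language ↔ g.Yields [.nonterminal g.initial] w := by
  rw [yields_iff_derives, mem_language_iff]

lemma Forest.mono {X Y : Set g.NT} {s : List (Symbol T g.NT)} {w : List T} (h : g.Forest X s w)
    (hYX : Y ⊆ X) : g.Forest Y s w := by
  induction h generalizing Y with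
  | nil => exact .nil Y
  | terminal a _ ih => exact .terminal a (ih hYX)
  | nonterminal hX hr _ _ ih₁ ih₂ =>
    exact .nonterminal (fun h => hX (hYX h)) hr (ih₁ (Set.insert_subset_insert hYX)) (ih₂ hYX)

lemma Forest.yields {X : Set g.NT} {s : List (Symbol T g.NT)} {w : List T} (h : g.Forest X s w) :
    g.Yields s w := by
  induction h with
  | nil => exact .nil
  | terminal a _ ih => exact .terminal a ih
  | nonterminal _ hr _ _ ih₁ ih₂ => exact .nonterminal hr ih₁ ih₂

lemma Forest.append {X : Set g.NT} {s t : List (Symbol T g.NT)} {u w : List T}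
    (hs : g.Forest X s u) (ht : g.Forest X t w) : g.Forest X (s ++ t) (u ++ w) := by
  induction hs with
  | nil => exact ht
  | terminal a _ ih => exact .terminal a (ih ht)
  | nonterminal hX hr ho _ _ ih => rw [List.append_assoc]; exact .nonterminal hX hr ho (ih ht)

/-- A repetition-free parse forest either avoids a nonterminal `A` or contains a subtree with
root `A`. -/
lemma Forest.avoid_or_exists_subtree {X : Set g.NT} {s : List (Symbol T g.NT)} {w : List T}
    (h : g.Forest X s w) (A : g.NT) :
    g.Forest (insert A X) s w ∨ ∃ v x y, w = v ++ x ++ y ∧ g.Forest ∅ [.nonterminal A] x ∧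
      ∀ x', g.Yields [.nonterminal A] x' → g.Yields s (v ++ x' ++ y) := by
  induction h with
  | nil => exact .inl (.nil _)
  | terminal a _ ih =>
    rcases ih with ih | ⟨v, x, y, rfl, hx, hs⟩
    · exact .inl (.terminal a ih)
    · exact .inr ⟨a :: v, x, y, rfl, hx, fun x' h => .terminal a (hs x' h)⟩
  | @nonterminal X r s u w hX hr ho hs ih₁ ih₂ =>
    by_cases hA : r.input = A
    · refine .inr ⟨[], u, w, rfl, ?_, fun x' h => by simpa [hA] using h.append hs.yields⟩
      have := Forest.nonterminal (g := g) (Set.notMem_empty _) hr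
        (ho.mono (Set.insert_subset_insert (Set.empty_subset X))) (.nil _)
      simpa [hA] using this
    rcases ih₁ with ih₁ | ⟨v, x, y, rfl, hx, hv⟩
    · rcases ih₂ with ih₂ | ⟨v, x, y, rfl, hx, hv⟩
      · rw [Set.insert_comm] at ih₁
        exact .inl (.nonterminal (by simp [hA, hX]) hr ih₁ ih₂)
      · refine .inr ⟨u ++ v, x, y, by simp, hx, fun x' h => ?_⟩
        simpa using Yields.nonterminal hr ho.yields (hv x' h)
    · refine .inr ⟨v, x, y ++ w, by simp, hx, fun x' h => ?_⟩
      simpa using Yields.nonterminal hr (hv x' h) hs.yields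

/-- Along a path the nonterminals are distinct, outside `X`, and left sides of rules. The exponent
thus bounds the nesting depth, and `b` bounds the branching. -/
lemma Forest.length_le {b : ℕ} (hb : 1 ≤ b) (hg : ∀ r ∈ g.rules, r.output.length ≤ b)
    {X : Set g.NT} {s : List (Symbol T g.NT)} {w : List T} (h : g.Forest X s w) :
    w.length ≤ s.length * b ^ ((·.input) '' (g.rules : Set (ContextFreeRule T g.NT)) \ X).ncard := by
  induction h with
  | nil => simp
  | @terminal X a s w _ ih =>
    have := Nat.one_le_pow
      ((·.input) '' (g.rules : Set (ContextFreeRule T g.NT)) \ X).ncard b hb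
    simp only [List.length_cons, add_mul, one_mul]
    exact Nat.add_le_add ih this
  | @nonterminal X r s u w hX hr ho hs ih₁ ih₂ =>
    have hcard : ((·.input) '' (g.rules : Set (ContextFreeRule T g.NT)) \
        insert r.input X).ncard + 1 ≤
        ((·.input) '' (g.rules : Set (ContextFreeRule T g.NT)) \ X).ncard := by
      rw [Nat.add_one_le_iff]
      refine Set.ncard_lt_ncard (Set.ssubset_iff_of_subset
        (Set.sdiff_subset_sdiff_right (Set.subset_insert _ _)) |>.2
        ⟨r.input, ⟨⟨r, hr, rfl⟩, hX⟩, fun h => h.2 (Set.mem_insert _ _)⟩)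
        ((g.rules.finite_toSet.image _).sdiff)
    have h₁ : u.length ≤ b ^ ((·.input) '' (g.rules : Set (ContextFreeRule T g.NT)) \ X).ncard :=
      ih₁.trans <| (Nat.mul_le_mul_right _ (hg r hr)).trans <| by
        rw [← pow_succ']; exact Nat.pow_le_pow_right hb hcard
    simp only [List.length_cons, List.length_append, add_mul, one_mul]
    omega

/-- Every yield of a sentential form comes from a repetition-free forest or can be pumped. -/
lemma Yields.forest_or_pump {p : ℕ}
    (hp : ∀ r ∈ g.rules, ∀ w, g.Forest ∅ r.output w → w.length ≤ p)
    {s : List (Symbol T g.NT)} {w : List T} (h : g.Yields s w) :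
    g.Forest ∅ s w ∨ ∃ u v x y z, w = u ++ v ++ x ++ y ++ z ∧ (v ++ x ++ y).length ≤ p ∧
      1 ≤ (v ++ y).length ∧ g.Yields s (u ++ v ++ v ++ x ++ y ++ y ++ z) := by
  induction h with
  | nil => exact .inl (.nil _)
  | terminal a _ ih =>
    rcases ih with ih | ⟨u, v, x, y, z, rfl, h₁, h₂, h₃⟩
    · exact .inl (.terminal a ih)
    · exact .inr ⟨a :: u, v, x, y, z, rfl, h₁, h₂, .terminal a h₃⟩
  | @nonterminal r s t w hr ho hs ih₁ ih₂ =>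
    rcases ih₂ with ih₂ | ⟨u, v, x, y, z, rfl, h₁, h₂, h₃⟩
    swap
    · refine .inr ⟨t ++ u, v, x, y, z, by simp, h₁, h₂, ?_⟩
      simpa using Yields.nonterminal hr ho h₃
    rcases ih₁ with ih₁ | ⟨u, v, x, y, z, rfl, h₁, h₂, h₃⟩
    swap
    · refine .inr ⟨u, v, x, y, z ++ w, by simp, h₁, h₂, ?_⟩
      simpa using Yields.nonterminal hr h₃ hs
    rcases ih₁.avoid_or_exists_subtree r.input with h | ⟨v, x, y, rfl, hx, hv⟩
    · exact .inl (.nonterminal (Set.notMem_empty _) hr h ih₂)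
    -- If `v` and `y` are empty, the inner subtree has the same yield and replaces the whole tree,
    -- with no repetition left. Otherwise inserting the context `v`, `y` twice pumps.
    by_cases hvy : v ++ y = []
    · obtain ⟨rfl, rfl⟩ := List.append_eq_nil_iff.1 hvy
      left
      simpa using hx.append ih₂
    · refine .inr ⟨[], v, x, y, w, by simp, hp r hr _ ih₁, List.length_pos_iff.2 hvy, ?_⟩
      have := Yields.nonterminal hr (hv _ (.single hr (hv _ hx.yields))) hs
      simpa using this

end ContextFreeGrammar

/-- The pumping lemma for context-free languages (with a single pumping). -/
theorem Language.IsContextFree.exists_pump {T : Type*} {L : Language T} (hL : L.IsContextFree) :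
    ∃ p : ℕ, ∀ w ∈ L, p < w.length → ∃ u v x y z, w = u ++ v ++ x ++ y ++ z ∧
      (v ++ x ++ y).length ≤ p ∧ 1 ≤ (v ++ y).length ∧ u ++ v ++ v ++ x ++ y ++ y ++ z ∈ L := by
  obtain ⟨g, rfl⟩ := hL
  obtain ⟨b, hb⟩ : ∃ b, 1 ≤ b ∧ ∀ r ∈ g.rules, r.output.length ≤ b :=
    ⟨g.rules.sup (·.output.length) + 1, by omega, fun r hr =>
      (Finset.le_sup (f := (·.output.length)) hr).trans (Nat.le_succ _)⟩
  -- `c` bounds the repetition-free yields of one nonterminal, and `b * c` those of the right side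
  -- of a rule.
  set c := b ^ ((·.input) '' (g.rules : Set (ContextFreeRule T g.NT)) \ ∅).ncard
  refine ⟨b * c, fun w hw hlen => ?_⟩
  have hp : ∀ r ∈ g.rules, ∀ w, g.Forest ∅ r.output w → w.length ≤ b * c := fun r hr w h =>
    (h.length_le hb.1 hb.2).trans (Nat.mul_le_mul_right _ (hb.2 r hr))
  rcases (ContextFreeGrammar.mem_language_iff_yields.1 hw).forest_or_pump hp with h | h
  · have := h.length_le hb.1 hb.2
    have := Nat.mul_le_mul_right c hb.1
    simp only [List.length_singleton] at *
    omega
  · obtain ⟨u, v, x, y, z, h₁, h₂, h₃, h₄⟩ := h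
    exact ⟨u, v, x, y, z, h₁, h₂, h₃, ContextFreeGrammar.mem_language_iff_yields.2 h₄⟩

/-! ### Stack systems and the grammar of their balanced computations. -/

/-- A transition system with states `S` and a stack over `G`; a transition reads a letter, does
nothing visible, pushes a stack symbol, or pops one. -/
structure StackSystem (α S G : Type*) where
  read : S → α → S → Prop
  silent : S → S → Prop
  push : S → G → S → Prop
  pop : S → G → S → Prop

namespace StackSystem

variable {α S G : Type*} {T : StackSystem α S G}

/-- `T.Balanced σ w τ`: some computation leads from `σ` to `τ`, reads `w`, never pops below its
initial stack, and ends with the initial stack. -/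
inductive Balanced (T : StackSystem α S G) : S → List α → S → Prop
  | refl (σ : S) : Balanced T σ [] σ
  | silent {σ τ : S} : T.silent σ τ → Balanced T σ [] τ
  | read {σ τ : S} {a : α} : T.read σ a τ → Balanced T σ [a] τ
  | trans {σ τ ρ : S} {u v : List α} :
      Balanced T σ u τ → Balanced T τ v ρ → Balanced T σ (u ++ v) ρ
  | nest {σ σ' τ' τ : S} {g : G} {w : List α} :
      T.push σ g σ' → Balanced T σ' w τ' → T.pop τ' g τ → Balanced T σ w τ

/-- `T.Reaches σ₀ w τ m`: some computation that begins in `σ₀` with the empty stack reads `w` and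
ends in `τ` with the stack `m`. -/
inductive Reaches (T : StackSystem α S G) (σ₀ : S) : List α → S → List G → Prop
  | base {w : List α} {τ : S} : T.Balanced σ₀ w τ → Reaches T σ₀ w τ []
  | push {u v : List α} {ρ ρ' τ : S} {g : G} {m : List G} :
      Reaches T σ₀ u ρ m → T.push ρ g ρ' → T.Balanced ρ' v τ → Reaches T σ₀ (u ++ v) τ (g :: m)

namespace Reaches

variable {σ₀ τ ρ : S} {u v : List α} {m : List G} {g : G}

lemma balanced (h : T.Reaches σ₀ u τ m) (hb : T.Balanced τ v ρ) :
    T.Reaches σ₀ (u ++ v) ρ m := by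
  cases h with
  | base h => exact .base (h.trans hb)
  | push h hp hb' => rw [List.append_assoc]; exact .push h hp (hb'.trans hb)

lemma silent (h : T.Reaches σ₀ u τ m) (hs : T.silent τ ρ) : T.Reaches σ₀ u ρ m := by
  simpa using h.balanced (.silent hs)

lemma read {a : α} (h : T.Reaches σ₀ u τ m) (hs : T.read τ a ρ) :
    T.Reaches σ₀ (u ++ [a]) ρ m :=
  h.balanced (.read hs)

lemma spill (h : T.Reaches σ₀ u τ m) (hp : T.push τ g ρ) : T.Reaches σ₀ u ρ (g :: m) := by
  simpa using Reaches.push h hp (.refl ρ)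

lemma pop (h : T.Reaches σ₀ u τ (g :: m)) (hp : T.pop τ g ρ) : T.Reaches σ₀ u ρ m := by
  cases h with
  | push h hp' hb => exact h.balanced (.nest hp' hb hp)

lemma balanced_of_nil (h : T.Reaches σ₀ u τ []) : T.Balanced σ₀ u τ := by
  cases h with
  | base h => exact h

end Reaches

section Grammar

variable {n : ℕ} (T) (e : Fin n → S) (σ₀ : S) (F : Set S)

/-- The rules of a grammar for the words read by balanced computations between
states numbered by `e`; the nonterminal `none` is initial. -/
inductive GrammarRule :
    ContextFreeRule α (Option (Fin n × Fin n)) → Prop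
  | initial {i j : Fin n} : e i = σ₀ → e j ∈ F →
      GrammarRule ⟨none, [.nonterminal (some (i, j))]⟩
  | refl {i j : Fin n} : e i = e j → GrammarRule ⟨some (i, j), []⟩
  | silent {i j : Fin n} : T.silent (e i) (e j) → GrammarRule ⟨some (i, j), []⟩
  | read {i j : Fin n} {a : α} : T.read (e i) a (e j) →
      GrammarRule ⟨some (i, j), [.terminal a]⟩
  | trans (i j k : Fin n) :
      GrammarRule ⟨some (i, k), [.nonterminal (some (i, j)), .nonterminal (some (j, k))]⟩
  | nest {i i' j' j : Fin n} {g : G} : T.push (e i) g (e i') → T.pop (e j') g (e j) →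
      GrammarRule ⟨some (i, j), [.nonterminal (some (i', j'))]⟩

/-- The stack symbol in `nest` does not occur in the rule itself, so only the pairs of state numbers
and the letters have to be finite in number. -/
lemma finite_grammarRule [Finite α] : {r | T.GrammarRule e σ₀ F r}.Finite := by
  let N := Option (Fin n × Fin n)
  refine (((Set.finite_range fun A : N => (⟨A, []⟩ : ContextFreeRule α N)).union
    (Set.finite_range fun A : N × α => ⟨A.1, [.terminal A.2]⟩)).union
    ((Set.finite_range fun A : N × N => ⟨A.1, [.nonterminal A.2]⟩).union
    (Set.finite_range fun A : N × N × N =>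
      ⟨A.1, [.nonterminal A.2.1, .nonterminal A.2.2]⟩))).subset ?_
  intro r hr
  simp only [Set.mem_union, Set.mem_range]
  cases hr with
  | initial => exact .inr (.inl ⟨(_, _), rfl⟩)
  | refl => exact .inl (.inl ⟨_, rfl⟩)
  | silent => exact .inl (.inl ⟨_, rfl⟩)
  | read => exact .inl (.inr ⟨(_, _), rfl⟩)
  | trans => exact .inr (.inr ⟨(_, _, _), rfl⟩)
  | nest => exact .inr (.inl ⟨(_, _), rfl⟩)

/-- The grammar with the rules `GrammarRule`. -/
noncomputable def grammar [Finite α] : ContextFreeGrammar α where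
  NT := Option (Fin n × Fin n)
  initial := none
  rules := (finite_grammarRule T e σ₀ F).toFinset

/-- The words that a nonterminal of the grammar is meant to generate. -/
def grammarSem : Option (Fin n × Fin n) → List α → Prop
  | none, w => ∃ τ ∈ F, T.Balanced σ₀ w τ
  | some (i, j), w => T.Balanced (e i) w (e j)

/-- The words that a sentential form of the grammar is meant to generate. -/
def formSem : List (Symbol α (Option (Fin n × Fin n))) → List α → Prop
  | [], w => w = []
  | .terminal a :: s, w => ∃ v, w = a :: v ∧ formSem s v
  | .nonterminal A :: s, w => ∃ u v, w = u ++ v ∧ T.grammarSem e σ₀ F A u ∧ formSem s v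

variable {T e σ₀ F}

/-- Soundness of the grammar: each rule mirrors a closure property of `Balanced`. -/
lemma GrammarRule.sem {r : ContextFreeRule α (Option (Fin n × Fin n))} {w : List α}
    (hr : T.GrammarRule e σ₀ F r) (h : T.formSem e σ₀ F r.output w) :
    T.grammarSem e σ₀ F r.input w := by
  cases hr with
  | initial hi hj =>
    obtain ⟨u, v, rfl, hu, rfl⟩ := h
    subst hi
    exact ⟨_, hj, by simpa [grammarSem] using hu⟩
  | refl hij => obtain rfl : w = [] := h; simpa [grammarSem, hij] using Balanced.refl _
  | silent hs => obtain rfl : w = [] := h; exact .silent hs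
  | read hs => obtain ⟨v, rfl, rfl⟩ := h; exact .read hs
  | trans i j k =>
    obtain ⟨u, v, rfl, hu, x, y, rfl, hx, rfl⟩ := h
    simpa [grammarSem] using Balanced.trans (T := T) hu (Balanced.trans hx (.refl _))
  | nest hp hq =>
    obtain ⟨u, v, rfl, hu, rfl⟩ := h
    simpa [grammarSem] using Balanced.trans (Balanced.nest (T := T) hp hu hq) (.refl _)

lemma formSem_of_yields [Finite α] {s : List (Symbol α (T.grammar e σ₀ F).NT)} {w : List α}
    (h : (T.grammar e σ₀ F).Yields s w) : T.formSem e σ₀ F s w := by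
  induction h with
  | nil => rfl
  | terminal a _ ih => exact ⟨_, rfl, ih⟩
  | nonterminal hr _ _ ih₁ ih₂ =>
    exact ⟨_, _, rfl, GrammarRule.sem ((Set.Finite.mem_toFinset _).1 hr) ih₁, ih₂⟩

lemma GrammarRule.yields [Finite α] {A : Option (Fin n × Fin n)}
    {s : List (Symbol α (Option (Fin n × Fin n)))} {w : List α}
    (hr : T.GrammarRule e σ₀ F ⟨A, s⟩) (h : (T.grammar e σ₀ F).Yields s w) :
    (T.grammar e σ₀ F).Yields [.nonterminal A] w :=
  ContextFreeGrammar.Yields.single (g := T.grammar e σ₀ F) (r := ⟨A, s⟩)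
    ((Set.Finite.mem_toFinset _).2 hr) h

lemma Balanced.yields [Finite α] (he : Function.Surjective e) {σ τ : S} {w : List α}
    (h : T.Balanced σ w τ) {i j : Fin n} (hi : e i = σ) (hj : e j = τ) :
    (T.grammar e σ₀ F).Yields [.nonterminal (some (i, j))] w := by
  induction h generalizing i j with
  | refl σ => exact GrammarRule.yields (.refl (hi.trans hj.symm)) .nil
  | silent hs => subst hi hj; exact GrammarRule.yields (.silent hs) .nil
  | read hs => subst hi hj; exact GrammarRule.yields (.read hs) (.terminal _ .nil)
  | @trans σ τ ρ u v _ _ ih₁ ih₂ =>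
    obtain ⟨k, hk⟩ := he τ
    exact GrammarRule.yields (.trans i k j) ((ih₁ hi hk).append (ih₂ hk hj))
  | @nest σ σ' τ' τ g w hp _ hq ih =>
    obtain ⟨i', rfl⟩ := he σ'
    obtain ⟨j', rfl⟩ := he τ'
    subst hi hj
    exact GrammarRule.yields (.nest hp hq) (ih rfl rfl)

end Grammar

/-- The words read by balanced computations from `σ₀` to a state of `F` form a context-free
language, if there are finitely many states. -/
theorem isContextFree_balanced [Finite α] [Finite S] (T : StackSystem α S G) (σ₀ : S)
    (F : Set S) : Language.IsContextFree ({w | ∃ τ ∈ F, T.Balanced σ₀ w τ} : Language α) := by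
  -- Numbering the states puts the nonterminals into `Type`, whatever the universe of `S`.
  obtain ⟨n, ⟨e⟩⟩ := Finite.exists_equiv_fin S
  refine ⟨T.grammar e.symm σ₀ F, ?_⟩
  ext w
  rw [ContextFreeGrammar.mem_language_iff_yields]
  constructor
  · intro h
    obtain ⟨u, v, rfl, hu, rfl⟩ := formSem_of_yields h
    rw [List.append_nil]
    exact hu
  · rintro ⟨τ, hτ, h⟩
    exact GrammarRule.yields (.initial (i := e σ₀) (j := e τ) (by simp) (by simpa))
      (h.yields e.symm.surjective (by simp) (by simp))

end StackSystem

/-! ### The product system and its soundness. -/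

namespace PDA

variable {α Q Γ : Type*}

/-- `M.Moves q s w q' s'`: some computation of `M` reads `w` and leads from the state `q` with the
stack `s` to the state `q'` with the stack `s'`. -/
inductive Moves (M : PDA α Q Γ) (q : Q) (s : List Γ) : List α → Q → List Γ → Prop
  | refl : Moves M q s [] q s
  | step {w : List α} {a : α} {q₁ q₂ : Q} {o : Option Γ} {γs r : List Γ} :
      Moves M q s w q₁ (o.toList ++ r) → M.step q₁ a o γs q₂ →
        Moves M q s (w ++ [a]) q₂ (γs ++ r)

lemma Moves.trans {M : PDA α Q Γ} {q₁ q₂ q₃ : Q} {s₁ s₂ s₃ : List Γ} {u v : List α}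
    (h₁ : M.Moves q₁ s₁ u q₂ s₂) (h₂ : M.Moves q₂ s₂ v q₃ s₃) :
    M.Moves q₁ s₁ (u ++ v) q₃ s₃ := by
  induction h₂ with
  | refl => simpa using h₁
  | step _ hs ih => rw [← List.append_assoc]; exact .step ih hs

lemma Moves.exists_run {M : PDA α Q Γ} {w : List α} {q : Q} {s : List Γ}
    (h : M.Moves M.start [] w q s) : ∃ s' A, M.Run w q s' A ∧ s'.map Prod.fst = s := by
  induction h with
  | refl => exact ⟨[], ∅, .nil, rfl⟩
  | @step w a q₁ q₂ o γs r _ hs ih =>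
    obtain ⟨s', A, hrun, hs'⟩ := ih
    cases o with
    | none => exact ⟨_, _, .noPop hrun hs, by simpa [Function.comp_def] using hs'⟩
    | some γ =>
      rw [Option.toList_some, List.singleton_append, List.map_eq_cons_iff] at hs'
      obtain ⟨⟨γ', i⟩, s', rfl, rfl, rfl⟩ := hs'
      exact ⟨_, _, .pop hrun hs, by simp [Function.comp_def]⟩

variable (Q Γ) in
/-- A state of a pushdown automaton together with at most `K` symbols from the top of its stack
and a flag. The rest of the stack is kept elsewhere; the flag forbids to forget symbols. -/
abbrev Local (K : ℕ) : Type _ := Q × {l : List Γ // l.length ≤ K} × Bool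

namespace Local

variable {K : ℕ}

/-- A step of the automaton that only touches the symbols at hand. -/
def Read (M : PDA α Q Γ) (σ : Local Q Γ K) (a : α) (τ : Local Q Γ K) : Prop :=
  τ.2.2 = σ.2.2 ∧ ∃ o γs r, M.step σ.1 a o γs τ.1 ∧ σ.2.1.1 = o.toList ++ r ∧ τ.2.1.1 = γs ++ r

/-- Forget the lowest symbols at hand. -/
def Discard (σ τ : Local Q Γ K) : Prop :=
  τ.1 = σ.1 ∧ σ.2.2 = false ∧ τ.2.2 = false ∧ τ.2.1.1 <+: σ.2.1.1

/-- Put away the lowest symbol at hand, together with the flag, and set the flag. -/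
def Spill (σ : Local Q Γ K) (g : Γ × Bool) (τ : Local Q Γ K) : Prop :=
  τ.1 = σ.1 ∧ σ.2.2 = g.2 ∧ τ.2.2 = true ∧ σ.2.1.1 = τ.2.1.1 ++ [g.1]

/-- Fetch a symbol put away, and restore the flag. -/
def Fetch (σ : Local Q Γ K) (g : Γ × Bool) (τ : Local Q Γ K) : Prop :=
  τ.1 = σ.1 ∧ σ.2.2 = true ∧ τ.2.2 = g.2 ∧ τ.2.1.1 = σ.2.1.1 ++ [g.1]

end Local

/-- A balanced computation of a stack system that simulates `M` on a component `π` of its states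
gives rise to a computation of `M`. -/
lemma moves_of_balanced {S G : Type*} {K : ℕ} (M : PDA α Q Γ) (T : StackSystem α S G)
    (π : S → Local Q Γ K)
    (hread : ∀ σ a τ, T.read σ a τ → Local.Read M (π σ) a (π τ))
    (hsilent : ∀ σ τ, T.silent σ τ → π σ = π τ ∨ Local.Discard (π σ) (π τ))
    (hnest : ∀ σ g σ' τ' τ, T.push σ g σ' → T.pop τ' g τ → (π σ = π σ' ∧ π τ' = π τ) ∨
      ∃ g', Local.Spill (π σ) g' (π σ') ∧ Local.Fetch (π τ') g' (π τ))
    {σ τ : S} {w : List α} (h : T.Balanced σ w τ) :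
    (π τ).2.2 = (π σ).2.2 ∧ ∃ d, ((π σ).2.2 = true → d = []) ∧
      ∀ r, M.Moves (π σ).1 ((π σ).2.1.1 ++ r) w (π τ).1 ((π τ).2.1.1 ++ (d ++ r)) := by
  induction h with
  | refl σ => exact ⟨rfl, [], fun _ => rfl, fun r => .refl⟩
  | @silent σ τ h =>
    rcases hsilent _ _ h with h | ⟨h₁, h₂, h₃, d, h₄⟩
    · rw [h]
      exact ⟨rfl, [], fun _ => rfl, fun r => .refl⟩
    · refine ⟨h₃.trans h₂.symm, d, fun h => by simp [h₂] at h, fun r => ?_⟩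
      rw [h₁, ← List.append_assoc, h₄]
      exact .refl
  | @read σ τ a h =>
    obtain ⟨h₁, o, γs, r', h₂, h₃, h₄⟩ := hread _ _ _ h
    refine ⟨h₁, [], fun _ => rfl, fun r => ?_⟩
    rw [h₃, h₄, List.append_assoc, List.append_assoc]
    exact .step (w := []) .refl h₂
  | @trans σ τ ρ u v _ _ ih₁ ih₂ =>
    obtain ⟨h₁, d₁, h₂, h₃⟩ := ih₁
    obtain ⟨h₄, d₂, h₅, h₆⟩ := ih₂
    refine ⟨h₄.trans h₁, d₂ ++ d₁, fun h => ?_, fun r => ?_⟩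
    · rw [h₂ h, h₅ (h₁.trans h)]; rfl
    · rw [List.append_assoc]
      exact (h₃ r).trans (h₆ _)
  | @nest σ σ' τ' τ g w hp hb hq ih =>
    obtain ⟨h₁, d, h₂, h₃⟩ := ih
    rcases hnest _ _ _ _ _ hp hq with ⟨h₄, h₅⟩ | ⟨⟨γ, f⟩, ⟨s₁, s₂, s₃, s₄⟩, f₁, f₂, f₃, f₄⟩
    · rw [h₄, ← h₅]
      exact ⟨h₁, d, h₂, h₃⟩
    -- With the flag set by the spill, nothing is forgotten in between (`d = []`). Hence `γ` still
    -- lies directly below the symbols at hand when it is fetched.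
    · refine ⟨f₃.trans s₂.symm, [], fun _ => rfl, fun r => ?_⟩
      have := h₃ (γ :: r)
      rw [h₂ s₃, s₁] at this
      rw [s₄, f₁, f₄]
      simpa using this

variable {Q₁ Q₂ Γ₁ Γ₂ : Type*} (M₁ : PDA α Q₁ Γ₁) (M₂ : PDA α Q₂ Γ₂) (K : ℕ)

/-- Two pushdown automata in parallel that keep at most `K` symbols each at hand and put away
the rest of both stacks on a common stack. -/
def prodSystem : StackSystem α (Local Q₁ Γ₁ K × Local Q₂ Γ₂ K) ((Γ₁ × Bool) ⊕ (Γ₂ × Bool)) where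
  read σ a τ := Local.Read M₁ σ.1 a τ.1 ∧ Local.Read M₂ σ.2 a τ.2
  silent σ τ := (Local.Discard σ.1 τ.1 ∧ σ.2 = τ.2) ∨ (σ.1 = τ.1 ∧ Local.Discard σ.2 τ.2)
  push σ g τ := g.elim (fun g => Local.Spill σ.1 g τ.1 ∧ σ.2 = τ.2)
    (fun g => σ.1 = τ.1 ∧ Local.Spill σ.2 g τ.2)
  pop σ g τ := g.elim (fun g => Local.Fetch σ.1 g τ.1 ∧ σ.2 = τ.2)
    (fun g => σ.1 = τ.1 ∧ Local.Fetch σ.2 g τ.2)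

/-- The initial configuration of an automaton. -/
def Local.init (M : PDA α Q Γ) (K : ℕ) : Local Q Γ K := (M.start, ⟨[], Nat.zero_le K⟩, M.emptyStack)

/-- The accepting configurations of an automaton. -/
def Local.Accepts (M : PDA α Q Γ) {K : ℕ} (σ : Local Q Γ K) : Prop :=
  σ.1 ∈ M.final ∧ (M.emptyStack = true → σ.2.1.1 = [])

/-- `d` collects the forgotten symbols. The initial flag is `M.emptyStack`, so `d` is empty whenever
acceptance requires an empty stack. -/
lemma mem_language_of_moves {M : PDA α Q Γ} {K : ℕ} {τ : Local Q Γ K} {w : List α}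
    (hτ : Local.Accepts M τ)
    (h : ∃ d, ((Local.init M K).2.2 = true → d = []) ∧ ∀ r, M.Moves (Local.init M K).1
      ((Local.init M K).2.1.1 ++ r) w τ.1 (τ.2.1.1 ++ (d ++ r))) : w ∈ M.language := by
  obtain ⟨d, hd, h⟩ := h
  obtain ⟨s, A, hrun, hs⟩ := (show M.Moves M.start [] w _ _ from h []).exists_run
  refine ⟨A, _, s, hrun, hτ.1, fun hM => ?_⟩
  rw [hτ.2 hM, hd hM] at hs
  simpa using hs

lemma mem_inf_language_of_balanced {M₁ : PDA α Q₁ Γ₁} {M₂ : PDA α Q₂ Γ₂} {K : ℕ}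
    {τ : Local Q₁ Γ₁ K × Local Q₂ Γ₂ K} {w : List α} (h₁ : Local.Accepts M₁ τ.1)
    (h₂ : Local.Accepts M₂ τ.2)
    (h : (prodSystem M₁ M₂ K).Balanced (Local.init M₁ K, Local.init M₂ K) w τ) :
    w ∈ M₁.language ⊓ M₂.language := by
  constructor
  · refine mem_language_of_moves h₁
      (moves_of_balanced M₁ (prodSystem M₁ M₂ K) Prod.fst ?_ ?_ ?_ h).2
    · exact fun σ a τ h => h.1
    · rintro σ τ (h | h)
      exacts [.inr h.1, .inl h.1]
    · rintro σ (g | g) σ' τ' τ hp hq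
      exacts [.inr ⟨g, hp.1, hq.1⟩, .inl ⟨hp.1, hq.1⟩]
  · refine mem_language_of_moves h₂
      (moves_of_balanced M₂ (prodSystem M₁ M₂ K) Prod.snd ?_ ?_ ?_ h).2
    · exact fun σ a τ h => h.2
    · rintro σ τ (h | h)
      exacts [.inl h.2, .inr h.2]
    · rintro σ (g | g) σ' τ' τ hp hq
      exacts [.inl ⟨hp.2, hq.2⟩, .inr ⟨g, hp.2, hq.2⟩]

instance [Finite Γ] (K : ℕ) : Finite {l : List Γ // l.length ≤ K} :=
  (List.finite_length_le Γ K).to_subtype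

lemma isContextFree_balanced_prodSystem [Finite α] [Finite Q₁] [Finite Q₂] [Finite Γ₁]
    [Finite Γ₂] : Language.IsContextFree ({w | ∃ τ ∈ {τ | Local.Accepts M₁ τ.1 ∧
      Local.Accepts M₂ τ.2}, (prodSystem M₁ M₂ K).Balanced (Local.init M₁ K, Local.init M₂ K) w τ} :
      Language α) :=
  StackSystem.isContextFree_balanced ..

end PDA

/-! ### Computations with pop positions known in advance. -/

namespace PDA

variable {α Q Γ : Type*}

lemma Run.le_length {M : PDA α Q Γ} {w : List α} {q : Q} {s : List (Γ × ℕ)} {A : Set (ℕ × ℕ)}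
    (h : M.Run w q s A) : ∀ x ∈ s, x.2 ≤ w.length := by
  induction h with
  | nil => simp
  | noPop _ _ ih =>
    simp only [List.mem_append, List.mem_map, List.length_append, List.length_singleton]
    rintro x (⟨γ, -, rfl⟩ | hx)
    · exact le_rfl
    · exact (ih x hx).trans (Nat.le_succ _)
  | pop _ _ ih =>
    simp only [List.mem_append, List.mem_map, List.length_append, List.length_singleton]
    rintro x (⟨γ, -, rfl⟩ | hx)
    · exact le_rfl
    · exact (ih x (List.mem_cons_of_mem _ hx)).trans (Nat.le_succ _)

lemma Run.arc_le_length {M : PDA α Q Γ} {w : List α} {q : Q} {s : List (Γ × ℕ)}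
    {A : Set (ℕ × ℕ)} (h : M.Run w q s A) : ∀ x ∈ A, x.2 ≤ w.length := by
  induction h with
  | nil => simp
  | noPop _ _ ih => exact fun x hx => (ih x hx).trans (by simp)
  | pop _ _ ih =>
    rintro x (rfl | hx)
    · simp
    · exact (ih x hx).trans (by simp)

/-- A stack symbol with the positions at which it is pushed and popped. -/
abbrev Mark (Γ : Type*) := Γ × ℕ × ℕ

/-- Some computation of `M` reads `w` and ends in the state `q`; the symbols on its stack that will
be popped, with their arcs, which belong to `F`, are those of `l`. -/
def Labeled (M : PDA α Q Γ) (F : Set (ℕ × ℕ)) (w : List α) (q : Q) (l : List (Mark Γ)) : Prop :=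
  ∃ d A, M.Run w q (l.map (fun x => (x.1, x.2.1)) ++ d) A ∧ A ⊆ F ∧
    (M.emptyStack = true → d = []) ∧ l.Pairwise (·.2.2 < ·.2.2) ∧
    ∀ x ∈ l, w.length < x.2.2 ∧ x.2 ∈ F

lemma Labeled.push_le {M : PDA α Q Γ} {F : Set (ℕ × ℕ)} {w : List α} {q : Q} {l : List (Mark Γ)}
    (h : M.Labeled F w q l) {x : Mark Γ} (hx : x ∈ l) : x.2.1 ≤ w.length := by
  obtain ⟨d, A, hrun, -⟩ := h
  exact hrun.le_length (x.1, x.2.1) (List.mem_append_left _ (List.mem_map.2 ⟨x, hx, rfl⟩))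

lemma Labeled.of_nil {M : PDA α Q Γ} {F : Set (ℕ × ℕ)} {q : Q} {l : List (Mark Γ)}
    (h : M.Labeled F [] q l) : q = M.start ∧ l = [] := by
  obtain ⟨d, A, hrun, -⟩ := h
  generalize hs : l.map (fun x => (x.1, x.2.1)) ++ d = s at hrun
  generalize hw : ([] : List α) = w at hrun
  cases hrun with
  | nil => simp_all
  | noPop => simp at hw
  | pop => simp at hw

/-- A transition of `M` in terms of marked symbols: `p` is popped, `n` is pushed together with
symbols `d` that are never popped, and `r` stays. -/
structure MarkedStep (M : PDA α Q Γ) (t : ℕ) (q : Q) (a : α) (p n r : List (Mark Γ)) (d : List Γ)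
    (q' : Q) : Prop where
  step : ∃ o, M.step q a o (n.map Prod.fst ++ d) q' ∧ p.map Prod.fst = o.toList
  popped : ∀ x ∈ p, x.2.2 = t
  pushed : ∀ x ∈ n, x.2.1 = t
  dead : d ≠ [] → r = [] ∧ M.emptyStack = false

/-- The same stack is divided into live and dead symbols on one side, new and old symbols on the
other. If the first cut lies among the new symbols, some of them may be dead (`c`), but then no old
symbol is live. -/
lemma exists_marked_split {l : List (Mark Γ)} {d s : List (Γ × ℕ)} {γs : List Γ} {t : ℕ}
    (h : l.map (fun x => (x.1, x.2.1)) ++ d = γs.map (fun γ => (γ, t)) ++ s) :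
    ∃ n r c d', l = n ++ r ∧ γs = n.map Prod.fst ++ c ∧ (∀ x ∈ n, x.2.1 = t) ∧
      (c ≠ [] → r = [] ∧ d ≠ []) ∧ s = r.map (fun x => (x.1, x.2.1)) ++ d' ∧
      (d = [] → d' = []) := by
  rcases List.append_eq_append_iff.1 h with ⟨c, h₁, h₂⟩ | ⟨c, h₁, h₂⟩
  · obtain ⟨γs₁, γs₂, rfl, h₃, rfl⟩ := List.map_eq_append_iff.1 h₁
    refine ⟨l, [], γs₂, s, by simp, ?_, fun x hx => ?_, fun hc => ⟨rfl, ?_⟩, rfl, ?_⟩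
    · have := congrArg (List.map Prod.fst) h₃
      simp only [List.map_map, Function.comp_def, List.map_id'] at this
      rw [this]
    · have : (x.1, x.2.1) ∈ γs₁.map (fun γ => (γ, t)) := h₃ ▸ List.mem_map.2 ⟨x, hx, rfl⟩
      obtain ⟨_, -, h⟩ := List.mem_map.1 this
      exact (congrArg Prod.snd h).symm
    · rw [h₂]
      simp [hc]
    · intro hd
      rw [hd] at h₂
      exact (List.append_eq_nil_iff.1 h₂.symm).2
  · obtain ⟨n, r, rfl, h₃, rfl⟩ := List.map_eq_append_iff.1 h₁
    refine ⟨n, r, [], d, rfl, ?_, fun x hx => ?_, by simp, h₂, id⟩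
    · have := congrArg (List.map Prod.fst) h₃
      simp only [List.map_map, Function.comp_def, List.map_id'] at this
      simp [this]
    · have : (x.1, x.2.1) ∈ γs.map (fun γ => (γ, t)) := h₃ ▸ List.mem_map.2 ⟨x, hx, rfl⟩
      obtain ⟨_, -, h⟩ := List.mem_map.1 this
      exact (congrArg Prod.snd h).symm

/-- Marks speak about the future, so the computation is taken apart from its end: undoing the last
step puts the popped symbol back, marked with the present position, on top of the symbols due later.
-/
lemma Labeled.exists_markedStep {M : PDA α Q Γ} {F : Set (ℕ × ℕ)} {w : List α} {a : α} {q' : Q}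
    {l : List (Mark Γ)} (h : M.Labeled F (w ++ [a]) q' l) :
    ∃ q p n r d, M.Labeled F w q (p ++ r) ∧ l = n ++ r ∧
      M.MarkedStep (w.length + 1) q a p n r d q' := by
  obtain ⟨d, A, hrun, hA, hd, hl, hlF⟩ := h
  generalize hs : l.map (fun x => (x.1, x.2.1)) ++ d = s at hrun
  generalize hw : w ++ [a] = w' at hrun
  have hdead : ∀ {c : List Γ} {x : Prop}, (c ≠ [] → x ∧ d ≠ []) →
      c ≠ [] → x ∧ M.emptyStack = false := fun h hc =>
    ⟨(h hc).1, by by_contra hM; exact (h hc).2 (hd (by simpa using hM))⟩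
  cases hrun with
  | nil => simp at hw
  | @noPop w₁ q _ s A a₁ γs hrun hstep =>
    obtain ⟨rfl, ha⟩ := List.append_inj' hw rfl
    obtain rfl : a = a₁ := by simpa using ha
    obtain ⟨n, r, c, d', rfl, rfl, hn, hc, rfl, hd'⟩ := exists_marked_split hs
    rw [List.pairwise_append] at hl
    refine ⟨q, [], n, r, c, ⟨d', A, hrun, hA, fun h => hd' (hd h), hl.2.1, fun x hx => ?_⟩,
      rfl, ⟨none, hstep, rfl⟩, by simp, hn, hdead hc⟩
    have := hlF x (List.mem_append_right _ hx)
    simp only [List.length_append, List.length_singleton] at this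
    exact ⟨by omega, this.2⟩
  | @pop w₁ q _ s A a₁ γs γ i hrun hstep =>
    obtain ⟨rfl, ha⟩ := List.append_inj' hw rfl
    obtain rfl : a = a₁ := by simpa using ha
    obtain ⟨n, r, c, d', rfl, rfl, hn, hc, rfl, hd'⟩ := exists_marked_split hs
    rw [List.pairwise_append] at hl
    have hr : ∀ x ∈ r, w.length + 1 < x.2.2 ∧ x.2 ∈ F := fun x hx => by
      simpa using hlF x (List.mem_append_right _ hx)
    refine ⟨q, [(γ, i, w.length + 1)], n, r, c, ⟨d', A, hrun, (Set.subset_insert _ _).trans hA,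
      fun h => hd' (hd h), ?_, ?_⟩, rfl, ⟨some γ, hstep, rfl⟩, by simp, hn, hdead hc⟩
    · rw [List.singleton_append, List.pairwise_cons]
      exact ⟨fun x hx => (hr x hx).1, hl.2.1⟩
    · rw [List.singleton_append, List.forall_mem_cons]
      exact ⟨⟨Nat.lt_succ_self _, hA (Set.mem_insert _ _)⟩, fun x hx =>
        ⟨(Nat.lt_succ_self _).trans (hr x hx).1, (hr x hx).2⟩⟩

/-- A transition of `M` carried out on the symbols at hand. -/
lemma MarkedStep.local {M : PDA α Q Γ} {t K : ℕ} {q q' : Q} {a : α} {p n r s : List (Mark Γ)}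
    {d : List Γ} (h : M.MarkedStep t q a p n (r ++ s) d q') {f : Bool}
    (hf : M.emptyStack = false → s = [] → f = false) (hK : r.length + 2 ≤ K)
    (hp : ((p ++ r).map Prod.fst).length ≤ K) (hn : ((n ++ r).map Prod.fst).length ≤ K) :
    ∃ ρ : Local Q Γ K, Local.Read M (q, ⟨(p ++ r).map Prod.fst, hp⟩, f) a ρ ∧
      (ρ = (q', ⟨(n ++ r).map Prod.fst, hn⟩, f) ∨
        Local.Discard ρ (q', ⟨(n ++ r).map Prod.fst, hn⟩, f)) := by
  obtain ⟨⟨o, hstep, ho⟩, -, -, hd⟩ := h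
  have hlen := M.push_le _ _ _ _ _ hstep
  refine ⟨(q', ⟨(n.map Prod.fst ++ d) ++ r.map Prod.fst, ?_⟩, f),
    ⟨rfl, o, _, r.map Prod.fst, hstep, by simp [ho], rfl⟩, ?_⟩
  · simp only [List.length_append, List.length_map] at hlen ⊢
    omega
  · by_cases hd' : d = []
    · left
      simp [hd']
    -- Below dead symbols nothing is live, neither at hand nor put away; so the flag is off and they
    -- can be forgotten.
    · obtain ⟨hrs, hM⟩ := hd hd'
      obtain ⟨rfl, rfl⟩ := List.append_eq_nil_iff.1 hrs
      right
      exact ⟨rfl, hf hM rfl, hf hM rfl, by simp⟩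

end PDA

/-! ### Simulation of two computations on a common stack. -/

namespace PDA

variable {α Q₁ Q₂ Γ₁ Γ₂ : Type*} {M₁ : PDA α Q₁ Γ₁} {M₂ : PDA α Q₂ Γ₂} {K : ℕ}

/-- The position at which a marked symbol of either automaton is popped. -/
def popAt : Mark Γ₁ ⊕ Mark Γ₂ → ℕ := Sum.elim (·.2.2) (·.2.2)

/-- The part of a common stack that belongs to the first automaton. -/
abbrev lefts (m : List (Mark Γ₁ ⊕ Mark Γ₂)) : List (Mark Γ₁) := m.filterMap Sum.getLeft?

/-- The part of a common stack that belongs to the second automaton. -/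
abbrev rights (m : List (Mark Γ₁ ⊕ Mark Γ₂)) : List (Mark Γ₂) := m.filterMap Sum.getRight?

/-- Symbols must not be forgotten if the stack has to be emptied or if live symbols, listed in `l`,
were put away. -/
def lockFlag {α Q Γ : Type*} (M : PDA α Q Γ) (l : List (Mark Γ)) : Bool :=
  M.emptyStack || !l.isEmpty

lemma lockFlag_cons {α Q Γ : Type*} (M : PDA α Q Γ) (x : Mark Γ) (l : List (Mark Γ)) :
    lockFlag M (x :: l) = true := by simp [lockFlag]

lemma lockFlag_nil {α Q Γ : Type*} (M : PDA α Q Γ) :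
    lockFlag M [] = M.emptyStack := by simp [lockFlag]

variable (M₁ M₂) in
/-- The stack of the product system that corresponds to a stack of marked symbols. -/
def encode : List (Mark Γ₁ ⊕ Mark Γ₂) → List ((Γ₁ × Bool) ⊕ (Γ₂ × Bool))
  | [] => []
  | .inl x :: m => .inl (x.1, lockFlag M₁ (lefts m)) :: encode m
  | .inr x :: m => .inr (x.1, lockFlag M₂ (rights m)) :: encode m

variable (M₁ M₂ K) in
/-- The product system can read `w` and end with the states `q₁`, `q₂`, the symbols `b₁`, `b₂` at
hand and the common stack `m`. -/
def Simulates (w : List α) (q₁ : Q₁) (q₂ : Q₂) (b₁ : List (Mark Γ₁)) (b₂ : List (Mark Γ₂))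
    (m : List (Mark Γ₁ ⊕ Mark Γ₂)) : Prop :=
  ∃ (h₁ : (b₁.map Prod.fst).length ≤ K) (h₂ : (b₂.map Prod.fst).length ≤ K),
    (prodSystem M₁ M₂ K).Reaches (Local.init M₁ K, Local.init M₂ K) w
      ((q₁, ⟨b₁.map Prod.fst, h₁⟩, lockFlag M₁ (lefts m)),
        (q₂, ⟨b₂.map Prod.fst, h₂⟩, lockFlag M₂ (rights m))) (encode M₁ M₂ m)

namespace Simulates

variable {w : List α} {q₁ q₁' : Q₁} {q₂ q₂' : Q₂} {b₁ : List (Mark Γ₁)} {b₂ : List (Mark Γ₂)}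
  {m : List (Mark Γ₁ ⊕ Mark Γ₂)}

lemma nil : Simulates M₁ M₂ K [] M₁.start M₂.start [] [] [] := by
  refine ⟨Nat.zero_le _, Nat.zero_le _, .base ?_⟩
  simpa [lockFlag, Local.init] using StackSystem.Balanced.refl _

lemma spill_left {x : Mark Γ₁} (h : Simulates M₁ M₂ K w q₁ q₂ (b₁ ++ [x]) b₂ m) :
    Simulates M₁ M₂ K w q₁ q₂ b₁ b₂ (.inl x :: m) := by
  obtain ⟨h₁, h₂, h⟩ := h
  have h₁' : (b₁.map Prod.fst).length ≤ K := by
    simp only [List.length_map, List.length_append] at h₁ ⊢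
    omega
  exact ⟨h₁', h₂, h.spill ⟨⟨rfl, rfl, lockFlag_cons _ _ _, by simp⟩, rfl⟩⟩

lemma spill_right {x : Mark Γ₂} (h : Simulates M₁ M₂ K w q₁ q₂ b₁ (b₂ ++ [x]) m) :
    Simulates M₁ M₂ K w q₁ q₂ b₁ b₂ (.inr x :: m) := by
  obtain ⟨h₁, h₂, h⟩ := h
  have h₂' : (b₂.map Prod.fst).length ≤ K := by
    simp only [List.length_map, List.length_append] at h₂ ⊢
    omega
  exact ⟨h₁, h₂', h.spill ⟨rfl, ⟨rfl, rfl, lockFlag_cons _ _ _, by simp⟩⟩⟩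

lemma fetch_left {x : Mark Γ₁} (h : Simulates M₁ M₂ K w q₁ q₂ b₁ b₂ (.inl x :: m))
    (hK : (b₁ ++ [x]).length ≤ K) : Simulates M₁ M₂ K w q₁ q₂ (b₁ ++ [x]) b₂ m := by
  obtain ⟨h₁, h₂, h⟩ := h
  exact ⟨by simpa using hK, h₂, h.pop ⟨⟨rfl, lockFlag_cons _ _ _, rfl, by simp⟩, rfl⟩⟩

lemma fetch_right {x : Mark Γ₂} (h : Simulates M₁ M₂ K w q₁ q₂ b₁ b₂ (.inr x :: m))
    (hK : (b₂ ++ [x]).length ≤ K) : Simulates M₁ M₂ K w q₁ q₂ b₁ (b₂ ++ [x]) m := by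
  obtain ⟨h₁, h₂, h⟩ := h
  exact ⟨h₁, by simpa using hK, h.pop ⟨rfl, ⟨rfl, lockFlag_cons _ _ _, rfl, by simp⟩⟩⟩

/-- The two spare places make room for all pushed symbols, including dead ones, which enter the hand
before they are discarded. -/
lemma read {t : ℕ} {a : α} {p₁ n₁ r₁ : List (Mark Γ₁)} {p₂ n₂ r₂ : List (Mark Γ₂)}
    {d₁ : List Γ₁} {d₂ : List Γ₂} (h : Simulates M₁ M₂ K w q₁ q₂ (p₁ ++ r₁) (p₂ ++ r₂) m)
    (hs₁ : M₁.MarkedStep t q₁ a p₁ n₁ (r₁ ++ lefts m) d₁ q₁')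
    (hs₂ : M₂.MarkedStep t q₂ a p₂ n₂ (r₂ ++ rights m) d₂ q₂')
    (hr₁ : r₁.length + 2 ≤ K) (hr₂ : r₂.length + 2 ≤ K) :
    Simulates M₁ M₂ K (w ++ [a]) q₁' q₂' (n₁ ++ r₁) (n₂ ++ r₂) m := by
  obtain ⟨h₁, h₂, h⟩ := h
  have hn₁ : ((n₁ ++ r₁).map Prod.fst).length ≤ K := by
    obtain ⟨o, hstep, -⟩ := hs₁.step
    have := M₁.push_le _ _ _ _ _ hstep
    simp only [List.length_append, List.length_map] at this ⊢
    omega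
  have hn₂ : ((n₂ ++ r₂).map Prod.fst).length ≤ K := by
    obtain ⟨o, hstep, -⟩ := hs₂.step
    have := M₂.push_le _ _ _ _ _ hstep
    simp only [List.length_append, List.length_map] at this ⊢
    omega
  refine ⟨hn₁, hn₂, ?_⟩
  obtain ⟨ρ₁, hread₁, hd₁⟩ := hs₁.local (f := lockFlag M₁ (lefts m))
    (fun hM hs => by rw [hs, lockFlag_nil, hM]) hr₁ h₁ hn₁
  obtain ⟨ρ₂, hread₂, hd₂⟩ := hs₂.local (f := lockFlag M₂ (rights m))
    (fun hM hs => by rw [hs, lockFlag_nil, hM]) hr₂ h₂ hn₂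
  have h := h.read (ρ := (ρ₁, ρ₂)) ⟨hread₁, hread₂⟩
  rcases hd₁ with rfl | hd₁ <;> rcases hd₂ with rfl | hd₂
  · exact h
  · exact h.silent (.inr ⟨rfl, hd₂⟩)
  · exact h.silent (.inl ⟨hd₁, rfl⟩)
  · exact (h.silent (ρ := (_, ρ₂)) (.inl ⟨hd₁, rfl⟩)).silent (.inr ⟨rfl, hd₂⟩)

end Simulates

/-- At most one symbol is popped per position, and `Ioc s t` has `t - s` positions. -/
lemma length_le_of_pairwise_pop {Γ : Type*} {l : List (Mark Γ)} {s t : ℕ}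
    (hl : l.Pairwise (·.2.2 < ·.2.2)) (hst : ∀ x ∈ l, s < x.2.2 ∧ x.2.2 ≤ t) :
    l.length ≤ t - s := by
  have hnd : (l.map (·.2.2)).Nodup := (List.pairwise_map.2 hl).imp Nat.ne_of_lt
  have hsub : (l.map (·.2.2)).toFinset ⊆ Finset.Ioc s t := by
    intro i hi
    obtain ⟨x, hx, rfl⟩ := List.mem_map.1 (List.mem_toFinset.1 hi)
    exact Finset.mem_Ioc.2 (hst x hx)
  simpa [List.toFinset_card_of_nodup hnd] using Finset.card_le_card hsub

/-- The symbols of the common stack that are popped at `c` at the latest can be fetched. -/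
lemma Simulates.fetch {w : List α} {q₁ : Q₁} {q₂ : Q₂} {l₁ : List (Mark Γ₁)}
    {l₂ : List (Mark Γ₂)} {s c : ℕ} (hK : c - s ≤ K)
    (hl₁ : l₁.Pairwise (·.2.2 < ·.2.2)) (hl₂ : l₂.Pairwise (·.2.2 < ·.2.2))
    (hs₁ : ∀ x ∈ l₁, s < x.2.2) (hs₂ : ∀ x ∈ l₂, s < x.2.2)
    (m : List (Mark Γ₁ ⊕ Mark Γ₂)) {b₁ : List (Mark Γ₁)} {b₂ : List (Mark Γ₂)}
    (h : Simulates M₁ M₂ K w q₁ q₂ b₁ b₂ m) (hm : m.Pairwise (popAt · ≤ popAt ·))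
    (hb₁ : ∀ x ∈ b₁, x.2.2 ≤ c) (hb₂ : ∀ x ∈ b₂, x.2.2 ≤ c)
    (h₁ : l₁ = b₁ ++ lefts m) (h₂ : l₂ = b₂ ++ rights m) :
    ∃ b₁ b₂ m, Simulates M₁ M₂ K w q₁ q₂ b₁ b₂ m ∧ m.Pairwise (popAt · ≤ popAt ·) ∧
      (∀ x ∈ b₁, x.2.2 ≤ c) ∧ (∀ x ∈ b₂, x.2.2 ≤ c) ∧ (∀ y ∈ m, c < popAt y) ∧
      l₁ = b₁ ++ lefts m ∧ l₂ = b₂ ++ rights m := by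
  induction m generalizing b₁ b₂ with
  | nil => exact ⟨b₁, b₂, [], h, hm, hb₁, hb₂, by simp, h₁, h₂⟩
  | cons y m ih =>
    rw [List.pairwise_cons] at hm
    by_cases hy : popAt y ≤ c
    swap
    · refine ⟨b₁, b₂, y :: m, h, List.pairwise_cons.2 hm, hb₁, hb₂, ?_, h₁, h₂⟩
      rw [List.forall_mem_cons]
      exact ⟨not_le.1 hy, fun z hz => (not_le.1 hy).trans_le (hm.1 z hz)⟩
    rcases y with x | x
    · have h₁' : l₁ = (b₁ ++ [x]) ++ lefts m := by simpa [lefts] using h₁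
      have hb : ∀ z ∈ b₁ ++ [x], z.2.2 ≤ c := by
        simp only [List.mem_append, List.mem_singleton]
        rintro z (hz | rfl)
        exacts [hb₁ z hz, hy]
      -- There is room for `x`: the enlarged hand is an initial part of `l₁`, all due in `Ioc s c`.
      refine ih (h.fetch_left ?_) hm.2 hb hb₂ h₁' h₂
      rw [h₁', List.pairwise_append] at hl₁
      refine (length_le_of_pairwise_pop hl₁.1 fun z hz => ⟨hs₁ z ?_, hb z hz⟩).trans hK
      rw [h₁']
      exact List.mem_append_left _ hz
    · have h₂' : l₂ = (b₂ ++ [x]) ++ rights m := by simpa [rights] using h₂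
      have hb : ∀ z ∈ b₂ ++ [x], z.2.2 ≤ c := by
        simp only [List.mem_append, List.mem_singleton]
        rintro z (hz | rfl)
        exacts [hb₂ z hz, hy]
      refine ih (h.fetch_right ?_) hm.2 hb₁ hb h₁ h₂'
      rw [h₂', List.pairwise_append] at hl₂
      refine (length_le_of_pairwise_pop hl₂.1 fun z hz => ⟨hs₂ z ?_, hb z hz⟩).trans hK
      rw [h₂']
      exact List.mem_append_left _ hz

lemma forall_pop_le_of_last {Γ : Type*} {b : List (Mark Γ)} {x : Mark Γ} {c : ℕ}
    (hb : (b ++ [x]).Pairwise (·.2.2 < ·.2.2)) (hx : x.2.2 ≤ c) :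
    ∀ z ∈ b ++ [x], z.2.2 ≤ c := by
  rw [List.pairwise_append] at hb
  simp only [List.mem_append, List.mem_singleton]
  rintro z (hz | rfl)
  exacts [(hb.2.2 z hz x (List.mem_singleton_self x)).le.trans hx, hx]

/-- The symbols at hand that are popped after `c` can be put away on the common stack. -/
lemma Simulates.spill {w : List α} {q₁ : Q₁} {q₂ : Q₂} {l₁ : List (Mark Γ₁)}
    {l₂ : List (Mark Γ₂)} {c : ℕ}
    (hl₁ : l₁.Pairwise (·.2.2 < ·.2.2)) (hl₂ : l₂.Pairwise (·.2.2 < ·.2.2))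
    (k : ℕ) (m : List (Mark Γ₁ ⊕ Mark Γ₂)) {b₁ : List (Mark Γ₁)} {b₂ : List (Mark Γ₂)}
    (hk : b₁.length + b₂.length ≤ k)
    (h : Simulates M₁ M₂ K w q₁ q₂ b₁ b₂ m) (hm : m.Pairwise (popAt · ≤ popAt ·))
    (hb₁ : ∀ x ∈ b₁, c < x.2.2 → ∀ y ∈ m, x.2.2 ≤ popAt y)
    (hb₂ : ∀ x ∈ b₂, c < x.2.2 → ∀ y ∈ m, x.2.2 ≤ popAt y)
    (h₁ : l₁ = b₁ ++ lefts m) (h₂ : l₂ = b₂ ++ rights m) :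
    ∃ b₁ b₂ m, Simulates M₁ M₂ K w q₁ q₂ b₁ b₂ m ∧ m.Pairwise (popAt · ≤ popAt ·) ∧
      (∀ x ∈ b₁, x.2.2 ≤ c) ∧ (∀ x ∈ b₂, x.2.2 ≤ c) ∧
      l₁ = b₁ ++ lefts m ∧ l₂ = b₂ ++ rights m := by
  induction k generalizing b₁ b₂ m with
  | zero =>
    obtain rfl := List.eq_nil_of_length_eq_zero (l := b₁) (by omega)
    obtain rfl := List.eq_nil_of_length_eq_zero (l := b₂) (by omega)
    exact ⟨[], [], m, h, hm, by simp, by simp, h₁, h₂⟩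
  | succ k ih =>
    have hp₁ : b₁.Pairwise (·.2.2 < ·.2.2) := (List.pairwise_append.1 (h₁ ▸ hl₁)).1
    have hp₂ : b₂.Pairwise (·.2.2 < ·.2.2) := (List.pairwise_append.1 (h₂ ▸ hl₂)).1
    -- Putting away the lowest symbol `x` of one hand keeps the invariant if nothing in the other
    -- hand is due later than `x`.
    have left : ∀ b x, b₁ = b ++ [x] → c < x.2.2 → (∀ z ∈ b₂, z.2.2 ≤ x.2.2) →
        ∃ b₁ b₂ m, Simulates M₁ M₂ K w q₁ q₂ b₁ b₂ m ∧ m.Pairwise (popAt · ≤ popAt ·) ∧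
          (∀ x ∈ b₁, x.2.2 ≤ c) ∧ (∀ x ∈ b₂, x.2.2 ≤ c) ∧
          l₁ = b₁ ++ lefts m ∧ l₂ = b₂ ++ rights m := by
      rintro b x rfl hx hz
      refine ih (.inl x :: m) ?_ h.spill_left ?_ ?_ ?_ (by simpa [lefts] using h₁) h₂
      · simp only [List.length_append, List.length_singleton] at hk
        omega
      · exact List.pairwise_cons.2 ⟨fun y hy => hb₁ x (by simp) hx y hy, hm⟩
      · intro z hzb hzc
        rw [List.forall_mem_cons]
        exact ⟨forall_pop_le_of_last hp₁ le_rfl z (List.mem_append_left _ hzb),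
          hb₁ z (List.mem_append_left _ hzb) hzc⟩
      · intro z hzb hzc
        rw [List.forall_mem_cons]
        exact ⟨hz z hzb, hb₂ z hzb hzc⟩
    have right : ∀ b x, b₂ = b ++ [x] → c < x.2.2 → (∀ z ∈ b₁, z.2.2 ≤ x.2.2) →
        ∃ b₁ b₂ m, Simulates M₁ M₂ K w q₁ q₂ b₁ b₂ m ∧ m.Pairwise (popAt · ≤ popAt ·) ∧
          (∀ x ∈ b₁, x.2.2 ≤ c) ∧ (∀ x ∈ b₂, x.2.2 ≤ c) ∧
          l₁ = b₁ ++ lefts m ∧ l₂ = b₂ ++ rights m := by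
      rintro b x rfl hx hz
      refine ih (.inr x :: m) ?_ h.spill_right ?_ ?_ ?_ h₁ (by simpa [rights] using h₂)
      · simp only [List.length_append, List.length_singleton] at hk
        omega
      · exact List.pairwise_cons.2 ⟨fun y hy => hb₂ x (by simp) hx y hy, hm⟩
      · intro z hzb hzc
        rw [List.forall_mem_cons]
        exact ⟨hz z hzb, hb₁ z hzb hzc⟩
      · intro z hzb hzc
        rw [List.forall_mem_cons]
        exact ⟨forall_pop_le_of_last hp₂ le_rfl z (List.mem_append_left _ hzb),
          hb₂ z (List.mem_append_left _ hzb) hzc⟩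
    by_cases hc : (∀ x ∈ b₁, x.2.2 ≤ c) ∧ ∀ x ∈ b₂, x.2.2 ≤ c
    · exact ⟨b₁, b₂, m, h, hm, hc.1, hc.2, h₁, h₂⟩
    rcases List.eq_nil_or_concat' b₁ with rfl | ⟨b, x, rfl⟩ <;>
      rcases List.eq_nil_or_concat' b₂ with rfl | ⟨b', x', rfl⟩
    · simp at hc
    · refine right b' x' rfl (not_le.1 fun hx => hc ?_) (by simp)
      exact ⟨by simp, forall_pop_le_of_last hp₂ hx⟩
    · refine left b x rfl (not_le.1 fun hx => hc ?_) (by simp)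
      exact ⟨forall_pop_le_of_last hp₁ hx, by simp⟩
    -- The lowest symbol of a hand is due last in it, so the later one of the two is due last of all
    -- symbols at hand and goes first.
    · rcases le_total x.2.2 x'.2.2 with hxx | hxx
      · refine right b' x' rfl (not_le.1 fun hx => hc ?_) (forall_pop_le_of_last hp₁ hxx)
        exact ⟨forall_pop_le_of_last hp₁ (hxx.trans hx), forall_pop_le_of_last hp₂ hx⟩
      · refine left b x rfl (not_le.1 fun hx => hc ?_) (forall_pop_le_of_last hp₂ hxx)
        exact ⟨forall_pop_le_of_last hp₁ hx, forall_pop_le_of_last hp₂ (hxx.trans hx)⟩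

end PDA

/-! ### Bounded crossings give a context-free intersection. -/

namespace PDA

variable {α Q₁ Q₂ Γ₁ Γ₂ : Type*} {M₁ : PDA α Q₁ Γ₁} {M₂ : PDA α Q₂ Γ₂} {K : ℕ}

lemma mem_lefts {m : List (Mark Γ₁ ⊕ Mark Γ₂)} {x : Mark Γ₁} : x ∈ lefts m ↔ .inl x ∈ m := by
  simp [lefts]

lemma mem_rights {m : List (Mark Γ₁ ⊕ Mark Γ₂)} {x : Mark Γ₂} : x ∈ rights m ↔ .inr x ∈ m := by
  simp [rights]

/-- After fetching, everything put away is due after `c`, so the symbols `p` to be popped are all at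
hand. -/
lemma exists_split_at_hand {Γ : Type*} {p r b s : List (Mark Γ)} {c : ℕ} (h : p ++ r = b ++ s)
    (hp : ∀ x ∈ p, x.2.2 ≤ c) (hs : ∀ x ∈ s, c < x.2.2) : ∃ r', b = p ++ r' ∧ r = r' ++ s := by
  rcases List.append_eq_append_iff.1 h with ⟨t, rfl, rfl⟩ | ⟨t, rfl, rfl⟩
  · exact ⟨t, rfl, rfl⟩
  · obtain rfl : t = [] := List.eq_nil_iff_forall_not_mem.2 fun x hx =>
      (hs x (List.mem_append_left _ hx)).not_ge (hp x (List.mem_append_right _ hx))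
    exact ⟨[], by simp, by simp⟩

/-- If two computations have no crossing arcs with an inner segment measure above `D`, the product
system can follow them. -/
lemma simulates_of_labeled {D : ℕ} {F₁ F₂ : Set (ℕ × ℕ)}
    (hF : ∀ i j i' j', IsCrossingPair F₁ F₂ i j i' j' → innerSegmentMeasure i i' j ≤ D)
    {w : List α} {q₁ : Q₁} {q₂ : Q₂} {l₁ : List (Mark Γ₁)} {l₂ : List (Mark Γ₂)}
    (h₁ : M₁.Labeled F₁ w q₁ l₁) (h₂ : M₂.Labeled F₂ w q₂ l₂) :
    ∃ b₁ b₂ m, Simulates M₁ M₂ (D + 3) w q₁ q₂ b₁ b₂ m ∧ m.Pairwise (popAt · ≤ popAt ·) ∧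
      (∀ x ∈ b₁, x.2.2 ≤ w.length + D) ∧ (∀ x ∈ b₂, x.2.2 ≤ w.length + D) ∧
      l₁ = b₁ ++ lefts m ∧ l₂ = b₂ ++ rights m := by
  induction w using List.reverseRecOn generalizing q₁ q₂ l₁ l₂ with
  | nil =>
    obtain ⟨rfl, rfl⟩ := h₁.of_nil
    obtain ⟨rfl, rfl⟩ := h₂.of_nil
    exact ⟨[], [], [], .nil, .nil, by simp, by simp, rfl, rfl⟩
  | append_singleton w a ih =>
    obtain ⟨q₁', p₁, n₁, r₁, d₁, hl₁, rfl, hs₁⟩ := h₁.exists_markedStep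
    obtain ⟨q₂', p₂, n₂, r₂, d₂, hl₂, rfl, hs₂⟩ := h₂.exists_markedStep
    obtain ⟨b₁, b₂, m, hsim, hm, hb₁, hb₂, he₁, he₂⟩ := ih hl₁ hl₂
    have ⟨_, _, _, _, _, hp₁, hx₁⟩ := hl₁
    have ⟨_, _, _, _, _, hp₂, hx₂⟩ := hl₂
    have ⟨_, _, _, _, _, hp₁', hx₁'⟩ := h₁
    have ⟨_, _, _, _, _, hp₂', hx₂'⟩ := h₂
    have hc : w.length + 1 + D - w.length ≤ D + 1 := by omega
    -- At most `D + 1` symbols per automaton are due in `Ioc w.length (w.length + 1 + D)`; with up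
    -- to two pushes this needs capacity `D + 3`.
    obtain ⟨b₁, b₂, m, hsim, hm, hb₁, hb₂, hmc, he₁, he₂⟩ :=
      hsim.fetch (s := w.length) (c := w.length + 1 + D) (by omega) hp₁ hp₂
        (fun x hx => (hx₁ x hx).1) (fun x hx => (hx₂ x hx).1) m hm
        (fun x hx => (hb₁ x hx).trans (by omega)) (fun x hx => (hb₂ x hx).trans (by omega)) he₁ he₂
    have hlen₁ : b₁.length ≤ D + 1 := (length_le_of_pairwise_pop
      (List.pairwise_append.1 (he₁ ▸ hp₁)).1 fun x hx =>
        ⟨(hx₁ x (he₁ ▸ List.mem_append_left _ hx)).1, hb₁ x hx⟩).trans hc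
    have hlen₂ : b₂.length ≤ D + 1 := (length_le_of_pairwise_pop
      (List.pairwise_append.1 (he₂ ▸ hp₂)).1 fun x hx =>
        ⟨(hx₂ x (he₂ ▸ List.mem_append_left _ hx)).1, hb₂ x hx⟩).trans hc
    obtain ⟨r₁, rfl, rfl⟩ := exists_split_at_hand he₁
      (fun x hx => (hs₁.popped x hx).le.trans (Nat.le_add_right _ D))
      (fun x hx => hmc _ (mem_lefts.1 hx))
    obtain ⟨r₂, rfl, rfl⟩ := exists_split_at_hand he₂
      (fun x hx => (hs₂.popped x hx).le.trans (Nat.le_add_right _ D))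
      (fun x hx => hmc _ (mem_rights.1 hx))
    rw [List.length_append] at hlen₁ hlen₂
    have hsim := hsim.read hs₁ hs₂ (by omega) (by omega)
    rw [List.length_append, List.length_singleton]
    refine hsim.spill hp₁' hp₂' _ m le_rfl hm ?_ ?_ (List.append_assoc ..).symm
      (List.append_assoc ..).symm
    · rintro x hx hxc (z | z) hz
      · rw [← List.append_assoc, List.pairwise_append] at hp₁'
        exact (hp₁'.2.2 x hx z (mem_lefts.2 hz)).le
      -- Here `x` is due too late to have been at hand before, so it is pushed right now, at
      -- `w.length + 1`. The symbol `z` of the other automaton was pushed earlier and is due after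
      -- `w.length + 1 + D`, but before `x`: the arcs cross with `j - i' > D`.
      · by_contra! hlt
        have hxn : x ∈ n₁ := (List.mem_append.1 hx).resolve_right fun h =>
          hxc.not_ge (hb₁ x (List.mem_append_right _ h))
        have hzm := mem_rights.2 hz
        have hpush := hl₂.push_le (x := z) (by simp [hzm])
        have hpop : _ < z.2.2 := hmc _ hz
        have hxt := hs₁.pushed x hxn
        have := hF z.2.1 z.2.2 x.2.1 x.2.2 ⟨.inr ⟨(hx₂' z (by simp [hzm])).2,
          (hx₁' x (by simp [hxn])).2⟩, by omega, by omega, hlt⟩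
        have := (le_max_right _ _).trans this
        omega
    · rintro x hx hxc (z | z) hz
      · by_contra! hlt
        have hxn : x ∈ n₂ := (List.mem_append.1 hx).resolve_right fun h =>
          hxc.not_ge (hb₂ x (List.mem_append_right _ h))
        have hzm := mem_lefts.2 hz
        have hpush := hl₁.push_le (x := z) (by simp [hzm])
        have hpop : _ < z.2.2 := hmc _ hz
        have hxt := hs₂.pushed x hxn
        have := hF z.2.1 z.2.2 x.2.1 x.2.2 ⟨.inl ⟨(hx₁' z (by simp [hzm])).2,
          (hx₂' x (by simp [hxn])).2⟩, by omega, by omega, hlt⟩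
        have := (le_max_right _ _).trans this
        omega
      · rw [← List.append_assoc, List.pairwise_append] at hp₂'
        exact (hp₂'.2.2 x hx z (mem_rights.2 hz)).le

lemma eq_nil_of_lefts_rights {m : List (Mark Γ₁ ⊕ Mark Γ₂)} (h₁ : lefts m = [])
    (h₂ : rights m = []) : m = [] := by
  refine List.eq_nil_iff_forall_not_mem.2 ?_
  rintro (x | x) hx
  · simpa [h₁] using mem_lefts.2 hx
  · simpa [h₂] using mem_rights.2 hx

/-- If the words of the intersection have accepting computations whose crossing pairs have bounded
inner segment measure, the intersection is context-free. -/
theorem isContextFree_inf_of_crossing_le [Finite α] [Finite Q₁] [Finite Q₂] [Finite Γ₁]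
    [Finite Γ₂] (M₁ : PDA α Q₁ Γ₁) (M₂ : PDA α Q₂ Γ₂) (D : ℕ)
    (h : ∀ w ∈ M₁.language ⊓ M₂.language, ∃ A₁ A₂ : Set (ℕ × ℕ), M₁.IsMatching w A₁ ∧
      M₂.IsMatching w A₂ ∧
      ∀ i j i' j' : ℕ, IsCrossingPair A₁ A₂ i j i' j' → innerSegmentMeasure i i' j ≤ D) :
    (M₁.language ⊓ M₂.language).IsContextFree := by
  refine cast (congrArg _ (Set.ext fun w => ?_))
    (isContextFree_balanced_prodSystem M₁ M₂ (D + 3))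
  symm
  constructor
  · intro hw
    obtain ⟨A₁, A₂, ⟨q₁, s₁, hr₁, hf₁, he₁⟩, ⟨q₂, s₂, hr₂, hf₂, he₂⟩, hF⟩ := h w hw
    -- At the end of the word nothing is live any more: what remains on the stacks is dead, so the
    -- hands and the common stack are empty.
    obtain ⟨b₁, b₂, m, ⟨_, _, hsim⟩, -, -, -, h₁, h₂⟩ := simulates_of_labeled
      (M₁ := M₁) (M₂ := M₂) (q₁ := q₁) (q₂ := q₂) (l₁ := []) (l₂ := []) hF
      ⟨s₁, A₁, hr₁, subset_rfl, he₁, .nil, by simp⟩ ⟨s₂, A₂, hr₂, subset_rfl, he₂, .nil, by simp⟩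
    obtain ⟨rfl, hm₁⟩ := List.append_eq_nil_iff.1 h₁.symm
    obtain ⟨rfl, hm₂⟩ := List.append_eq_nil_iff.1 h₂.symm
    obtain rfl := eq_nil_of_lefts_rights hm₁ hm₂
    exact ⟨_, ⟨⟨hf₁, fun _ => rfl⟩, ⟨hf₂, fun _ => rfl⟩⟩, hsim.balanced_of_nil⟩
  · rintro ⟨τ, ⟨h₁, h₂⟩, hb⟩
    exact mem_inf_language_of_balanced h₁ h₂ hb

end PDA

/-! ### Linkages and the pumping lemma. -/

/-- A word of a context-free language with linkages between the first and third and between the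
second and fourth of four segments has bounded inner segments. -/
theorem Language.IsContextFree.exists_innerSegmentMeasure_le {α : Type*} {L : Language α}
    (hL : L.IsContextFree) : ∃ p : ℕ, ∀ w ∈ L, ∀ i j i' : ℕ, i < i' → i' < j → j ≤ w.length →
      PumpSensitiveLinkage L (crossingSegments w i i' j) 0 2 →
      PumpSensitiveLinkage L (crossingSegments w i i' j) 1 3 → innerSegmentMeasure i i' j ≤ p := by
  obtain ⟨p, hp⟩ := hL.exists_pump
  refine ⟨p, fun w hw i j i' hii' hi'j hj h₁ h₂ => ?_⟩
  by_contra! hlt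
  have hlen : p < w.length := by unfold innerSegmentMeasure at hlt; omega
  obtain ⟨u, v, x, y, z, hwe, hle, hpos, hmem⟩ := hp w hw hlen
  have hflat : (crossingSegments w i i' j).flatten = u ++ v ++ x ++ y ++ z := by
    rw [← hwe]
    have e₁ : w.take i ++ (w.take i').drop i = w.take i' := by
      conv_rhs => rw [← List.take_append_drop i (w.take i')]
      rw [List.take_take, min_eq_left hii'.le]
    have e₂ : w.take i' ++ (w.take j).drop i' = w.take j := by
      conv_rhs => rw [← List.take_append_drop i' (w.take j)]
      rw [List.take_take, min_eq_left hi'j.le]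
    simp only [crossingSegments, List.flatten_cons, List.flatten_nil, List.append_nil]
    rw [← List.append_assoc, e₁, ← List.append_assoc, e₂, List.take_append_drop]
  have hwlen := congrArg List.length hwe
  have hP₀ : segmentPositions (crossingSegments w i i' j) 0 = Set.Ico 0 i := by
    simp [segmentPositions, crossingSegments]; congr 1; omega
  have hP₁ : segmentPositions (crossingSegments w i i' j) 1 = Set.Ico i i' := by
    simp [segmentPositions, crossingSegments]; congr 1 <;> omega
  have hP₂ : segmentPositions (crossingSegments w i i' j) 2 = Set.Ico i' j := by
    simp [segmentPositions, crossingSegments]; congr 1 <;> omega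
  have hP₃ : segmentPositions (crossingSegments w i i' j) 3 = Set.Ico j w.length := by
    simp [segmentPositions, crossingSegments]; congr 1 <;> omega
  have h₁ := mt (h₁ u v x y z hflat hpos) (not_not.2 hmem)
  have h₂ := mt (h₂ u v x y z hflat hpos) (not_not.2 hmem)
  unfold innerSegmentMeasure at hlt
  simp only [hP₀, hP₁, hP₂, hP₃, Set.Ico_inter_Ico, Set.nonempty_Ico, Set.Ico_disjoint_Ico,
    List.length_append] at h₁ h₂ hwlen hle hpos
  -- The window is nonempty, so it meets some segment and, by linkage, its partner. It then contains
  -- the nonempty inner segment between these, which belongs to the other pair. So the window meets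
  -- all four segments and contains `P₂` and `P₃`, although it has length at most `p`.
  omega

theorem mainTheorem7 {α Q₁ Q₂ Γ₁ Γ₂ : Type*} [Finite α] [Finite Q₁] [Finite Q₂] [Finite Γ₁]
    [Finite Γ₂] (M₁ : PDA α Q₁ Γ₁) (M₂ : PDA α Q₂ Γ₂) (L : Language α)
    (hL : L = M₁.language ⊓ M₂.language) :
    ((∃ D : ℕ, ∀ w ∈ L, ∃ A₁ A₂ : Set (ℕ × ℕ), M₁.IsMatching w A₁ ∧ M₂.IsMatching w A₂ ∧
        ∀ i j i' j' : ℕ, IsCrossingPair A₁ A₂ i j i' j' → innerSegmentMeasure i i' j ≤ D) →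
      L.IsContextFree) ∧
    ({n : ℕ | ∃ w ∈ L, ∃ A₁ A₂ : Set (ℕ × ℕ), M₁.IsMatching w A₁ ∧ M₂.IsMatching w A₂ ∧
        ∃ i j i' j' : ℕ, IsCrossingPair A₁ A₂ i j i' j' ∧
          PumpSensitiveLinkage L (crossingSegments w i i' j) 0 2 ∧
          PumpSensitiveLinkage L (crossingSegments w i i' j) 1 3 ∧
          n ≤ innerSegmentMeasure i i' j}.Infinite →
      ¬ L.IsContextFree) := by
  constructor
  · rintro ⟨D, h⟩
    subst hL
    exact PDA.isContextFree_inf_of_crossing_le M₁ M₂ D h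
  · intro hinf hcf
    obtain ⟨p, hp⟩ := hcf.exists_innerSegmentMeasure_le
    obtain ⟨n, ⟨w, hw, A₁, A₂, ⟨q₁, s₁, hr₁, -⟩, ⟨q₂, s₂, hr₂, -⟩, i, j, i', j',
      ⟨harc, hii', hi'j, hjj'⟩, h₁, h₂, hn⟩, hpn⟩ := hinf.exists_gt p
    -- Pops happen within the word; with `j < j'` this supplies `j ≤ w.length`.
    have hj' : j' ≤ w.length := by
      rcases harc with ⟨-, h⟩ | ⟨-, h⟩
      exacts [hr₂.arc_le_length _ h, hr₁.arc_le_length _ h]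
    have := hp w hw i j i' hii' hi'j (by omega) h₁ h₂
    omega
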